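/- Let $k\ge 1$ and $q\ge 0$ be integers. Let $R_{k,q}=\{x\in\mathbb R^{k-1}: 0\le x_1\le\cdots\le x_{k-1}\le q\}$ and $W_{k,q}=R_{k,q}\cap\mathbb Z^{k-1}$. For $v\in W_{k,q}$ with $v+(1,\dots,1)\in W_{k,q}$ and a permutation $\pi=\pi_1\cdots\pi_{k-1}$ of $\{1,\dots,k-1\}$ in which $i$ stands before $i+1$ whenever $v_i=v_{i+1}$, let $F(v,\pi)$ be the simplex with vertices $v,\ v+e_{\pi_{k-1}},\ v+e_{\pi_{k-1}}+e_{\pi_{k-2}},\ \dots,\ v+e_{\pi_{k-1}}+\cdots+e_{\pi_1}$. The edgewise subdivision $T_{k,q}$ of $R_{k,q}$ is the simplicial complex whose facets are these simplices. The star cluster $SC(F)$ of a face $F$ is the union of the closed stars in $T_{k,q}$ of the vertices of $F$. The $h$-vector $(h_0,\dots,h_{d+1})$ of a $d$-dimensional complex with $f_{i-1}$ faces on $i$ vertices ($f_{-1}=1$) is $h_s=\sum_{i=0}^s(-1)^{s-i}\binom{d+1-i}{d+1-s}f_{i-1}$. For a permutation $\pi\in\mathbb S_k$ let $\mathrm{des}(\pi)$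 be its number of descents and $\mathrm{init}(\pi)=\min\{t\ge 1:\{\pi_1,\dots,\pi_t\}=\{1,\dots,t\}\}$. Let $H_k=[h^k_{i,d}]_{1\le i,d\le k}$, where $h^k_{i,d}$ is the number of $\pi\in\mathbb S_k$ with $\mathrm{init}(\pi)=i$ and $\mathrm{des}(\pi)=d-1$, and let $\mathbf h^k_i=(h^k_{i,1},\dots,h^k_{i,k})$ be its $i$-th row. **Theorem.** Let $F=F(v,\mathrm{Id})$ be a facet of $T_{k,q}$ all of whose vertices lie in the interior of $R_{k,q}$. Then $SC(F)$ has dimension $k-1$, $h_k(SC(F))=0$, and $$\big(h_0(SC(F)),\dots,h_{k-1}(SC(F))\big)=(1,2,\dots,k)\,H_k=\sum_{i=1}^k i\cdot\mathbf h^k_i=k\cdot\mathbf h\big(Sd(\partial\Delta^{k-1})\big)-\sum_{i=1}^{k-1}(k-i)\cdot\mathbf h^k_i,$$ where $Sd(\partial\Delta^{k-1})$, a complex of dimension $k-2$, is the barycentric subdivision of the boundary of the $(k-1)$-simplex. Equivalently, for all $0\le j\le k$, $$h_j(SC(F))=\sum_{\pi\in\mathbb S_k,\ \mathrm{des}(\pi)=j}\mathrm{init}(\pi).$$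 -/

import Mathlib

open scoped Matrix

noncomputable section

namespace EdgewiseSubdivision

/-! ### Simplicial complexes: dimension, `f`- and `h`-vector, star, star cluster, subdivision -/

section Complexes

variable {ι : Type*}

/-- The number `d + 1`, where `d` is the dimension of the finite complex `K`: the largest number of
vertices of a face. It is `0` if the empty face is the only face. -/
def rank (K : PreAbstractSimplicialComplex ι) : ℕ :=
  sSup (Finset.card '' K.faces)

/-- `fNum K i` is `f_{i-1}`, the number of faces of `K` with exactly `i` vertices. Mathlib's
complexes do not list the empty face, so `f_{-1} = 1` is put in by hand. -/
def fNum (K : PreAbstractSimplicialComplex ι) (i : ℕ) : ℕ :=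
  if i = 0 then 1 else Set.ncard {s | s ∈ K.faces ∧ s.card = i}

/-- The entry `h_s` (`0 ≤ s ≤ d + 1`) of the `h`-vector of a `d`-dimensional complex,
`h_s = ∑_{i ≤ s} (-1)^(s-i) * C(d+1-i, d+1-s) * f_{i-1}`; extended by `0` to `s > d + 1`. -/
def hNum (K : PreAbstractSimplicialComplex ι) (s : ℕ) : ℤ :=
  if s ≤ rank K then
    ∑ i ∈ Finset.range (s + 1),
      (-1) ^ (s - i) * ((rank K - i).choose (rank K - s) : ℤ) * (fNum K i : ℤ)
  else 0

/-- The (closed) star of `σ` in `K`: all faces of the faces of `K` that contain `σ`. -/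
def star (K : PreAbstractSimplicialComplex ι) (σ : Finset ι) : PreAbstractSimplicialComplex ι where
  faces := {ρ | ρ.Nonempty ∧ ∃ τ ∈ K.faces, σ ⊆ τ ∧ ρ ⊆ τ}
  isRelLowerSet_faces := by
    rintro ρ ⟨hρ, τ, hτ, hσ, hρτ⟩
    exact ⟨hρ, fun _ hsub hne => ⟨hne, τ, hτ, hσ, subset_trans hsub hρτ⟩⟩

/-- The star cluster of `σ` in `K`: the union of the stars of the vertices of `σ`. -/
def starCluster (K : PreAbstractSimplicialComplex ι) (σ : Finset ι) :
    PreAbstractSimplicialComplex ι where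
  faces := {ρ | ∃ v ∈ σ, ρ ∈ (star K {v}).faces}
  isRelLowerSet_faces := by
    rintro ρ ⟨v, hv, hρ⟩
    exact ⟨hρ.1, fun _ hsub hne => ⟨v, hv, ((star K {v}).isRelLowerSet_faces hρ).2 hsub hne⟩⟩

/-- The barycentric subdivision of `K`: the vertices are the nonempty faces of `K` and the faces are
the chains of these, ordered by inclusion. -/
def barycentricSubdivision (K : PreAbstractSimplicialComplex ι) :
    PreAbstractSimplicialComplex (Finset ι) where
  faces := {c | c.Nonempty ∧ (∀ s ∈ c, s ∈ K.faces) ∧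
    IsChain (fun s t : Finset ι => s ⊆ t) (c : Set (Finset ι))}
  isRelLowerSet_faces := by
    rintro c ⟨hc, hK, hch⟩
    exact ⟨hc, fun _ hsub hne => ⟨hne, fun s hs => hK s (hsub hs),
      hch.mono (Finset.coe_subset.mpr hsub)⟩⟩

end Complexes

/-- The boundary of the `(k-1)`-simplex on `k` vertices. -/
def boundarySimplex (k : ℕ) : PreAbstractSimplicialComplex (Fin k) where
  faces := {s | s.Nonempty ∧ s ≠ Finset.univ}
  isRelLowerSet_faces := by
    rintro s ⟨hs, hs'⟩
    refine ⟨hs, fun t hsub hne => ⟨hne, ?_⟩⟩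
    rintro rfl
    exact hs' (Finset.univ_subset_iff.mp hsub)

/-! ### The edgewise subdivision -/

/-- The simplex `R_{k,q} = {x : 0 ≤ x_1 ≤ ⋯ ≤ x_{k-1} ≤ q}` in `ℝ^(k-1)`. -/
def R (k q : ℕ) : Set (Fin (k - 1) → ℝ) :=
  {x | (∀ i, 0 ≤ x i) ∧ Monotone x ∧ ∀ i, x i ≤ q}

/-- The vertex set `W_{k,q}`: the integer points `0 ≤ v_1 ≤ ⋯ ≤ v_{k-1} ≤ q`. -/
def W (k q : ℕ) : Set (Fin (k - 1) → ℤ) :=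
  {v | (∀ i, 0 ≤ v i) ∧ Monotone v ∧ ∀ i, v i ≤ q}

/-- `π` is consistent with `v`: the value `i` stands before `i + 1` in the word of `π` whenever
`v_i = v_{i+1}`. -/
def Consistent (k : ℕ) (v : Fin (k - 1) → ℤ) (π : Equiv.Perm (Fin (k - 1))) : Prop :=
  ∀ i j : Fin (k - 1), (i : ℕ) + 1 = j → v i = v j → π.symm i < π.symm j

/-- The vertex `v^(j+1)` of `F(v, π)`, for `j = 0, …, k - 1`: the vector `v` plus the unit vectors
of the last `j` letters of the word of `π`. -/
def facetVertex (k : ℕ) (v : Fin (k - 1) → ℤ) (π : Equiv.Perm (Fin (k - 1))) (j : ℕ) :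
    Fin (k - 1) → ℤ :=
  v + ∑ m with k - 1 ≤ (m : Fin (k - 1)).val + j, Pi.single (π m) 1

/-- The vertex set `{v^(1), …, v^(k)}` of the simplex `F(v, π)`. -/
def F (k : ℕ) (v : Fin (k - 1) → ℤ) (π : Equiv.Perm (Fin (k - 1))) :
    Finset (Fin (k - 1) → ℤ) :=
  (Finset.range k).image (facetVertex k v π)

/-- `F(v, π)` is a facet of `T_{k,q}`: `π` is consistent with `v`, and the first vertex `v` and the
last vertex `v + (1, …, 1)` belong to `W_{k,q}`. -/
def IsFacet (k q : ℕ) (v : Fin (k - 1) → ℤ) (π : Equiv.Perm (Fin (k - 1))) : Prop :=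
  v ∈ W k q ∧ v + 1 ∈ W k q ∧ Consistent k v π

/-- The edgewise subdivision `T_{k,q}` of `R_{k,q}`; a simplex is given by its set of vertices. -/
def T (k q : ℕ) : PreAbstractSimplicialComplex (Fin (k - 1) → ℤ) where
  faces := {ρ | ρ.Nonempty ∧ ∃ v π, IsFacet k q v π ∧ ρ ⊆ F k v π}
  isRelLowerSet_faces := by
    rintro ρ ⟨hρ, v, π, h, hsub⟩
    exact ⟨hρ, fun _ hsub' hne => ⟨hne, v, π, h, subset_trans hsub' hsub⟩⟩

/-- The star cluster in `T_{k,q}` of the facet `F(v, Id)`. -/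
def SC (k q : ℕ) (v : Fin (k - 1) → ℤ) : PreAbstractSimplicialComplex (Fin (k - 1) → ℤ) :=
  starCluster (T k q) (F k v 1)

/-- The barycentric subdivision `Sd(∂Δ^{k-1})` of the boundary of the `(k-1)`-simplex. -/
def SdBoundary (k : ℕ) : PreAbstractSimplicialComplex (Finset (Fin k)) :=
  barycentricSubdivision (boundarySimplex k)

/-! ### Permutation statistics -/

/-- The faithful initial part `init(π) = min {t ≥ 1 : {π_1, …, π_t} = {1, …, t}}`; positions and
letters are numbered from `0` here. -/
def init {n : ℕ} (π : Equiv.Perm (Fin n)) : ℕ :=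
  sInf {t | 1 ≤ t ∧ t ≤ n ∧
    π '' {i : Fin n | (i : ℕ) < t} = {i : Fin n | (i : ℕ) < t}}

/-- The number of descents of `π`. -/
def des {n : ℕ} (π : Equiv.Perm (Fin n)) : ℕ :=
  Set.ncard {i : Fin n | ∃ j : Fin n, (i : ℕ) + 1 = j ∧ π j < π i}

/-- The vector `𝐡^k_t`: its entry at the (0-based) place `d` is the number of permutations `π` of
`k` letters with `init π = t` and `des π = d`. -/
def hRow (k t : ℕ) : Fin k → ℤ := fun d =>
  (Set.ncard {π : Equiv.Perm (Fin k) | init π = t ∧ des π = (d : ℕ)} : ℤ)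

/-- The `k × k` matrix `H_k`, with rows `𝐡^k_1, …, 𝐡^k_k`. -/
def H (k : ℕ) : Matrix (Fin k) (Fin k) ℤ := Matrix.of fun i => hRow k ((i : ℕ) + 1)

end EdgewiseSubdivision

end

namespace EdgewiseSubdivision

/-! ### From `f`-vectors to `h`-vectors -/

/-! Near an interior vertex `w`, the subdivision is a flag complex: a set `ρ` lies in the closed
star of `w` iff `insert w ρ` consists of points pairwise differing by a 0-1-vector up to sign
(`mem_star_T_iff`). In `ℤ^k` modulo `(1, …, 1)` the points adjacent or equal to `w` are `w - 1_A`
for proper subsets `A` of `Fin k`, and adjacency is comparability (`adj_nbr_iff`). So the star is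
the complex of chains of proper subsets, with `∅` standing for `w`.

Label the coordinates so that, seen from the `i`-th vertex of `F(v, Id)`, the earlier vertices
become the initial segments of sizes `1, …, i` (`nbr_initSeg`). The faces new at step `i` are then
the chains comparable with none of these segments. Reading the blocks of a chain in increasing order
gives a permutation `π`; the chain is recovered from `π` and its set `D` of sizes, which can be any
set containing the descents. It is comparable with an initial segment iff `π` preserves that
segment, so new chains at step `i` are those with `i < init π` (`ncard_flags`).

Summing over `i` counts each `π` exactly `init π` times: `f_{m-1} = ∑ init π * C(k - des π, k - m)`.
Inverting the binomial transform gives the `h`-vector. Chains of nonempty proper subsets, with no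
condition on `init`, give the subdivided boundary in the same way. -/

theorem sum_neg_one_pow_mul_choose_mul_choose {d a s : ℕ} (ha : a ≤ d) (hs : s ≤ d) :
    ∑ i ∈ Finset.range (s + 1),
      (-1 : ℤ) ^ (s - i) * ((d - i).choose (d - s) : ℤ) * ((d - a).choose (d - i) : ℤ) =
      if a = s then 1 else 0 := by
  rcases lt_or_ge s a with h | h
  · rw [if_neg (by omega)]
    refine Finset.sum_eq_zero fun i hi => ?_
    have hi' := Finset.mem_range.mp hi
    rw [Nat.choose_eq_zero_of_lt (show d - a < d - i by omega)]
    simp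
  -- Trinomial revision pulls out a factor independent of `i`; what remains is an alternating row
  -- sum of binomials, zero unless `s = a`.
  · have key : ∀ i ∈ Finset.range (s + 1),
        (-1 : ℤ) ^ (s - i) * ((d - i).choose (d - s) : ℤ) * ((d - a).choose (d - i) : ℤ) =
          ((d - a).choose (d - s) : ℤ) * ((-1) ^ (s - i) * ((s - a).choose (s - i) : ℤ)) := by
      intro i hi
      have hi' := Finset.mem_range.mp hi
      have h1 : (d - a).choose (d - i) * (d - i).choose (d - s) =
          (d - a).choose (d - s) * (s - a).choose (s - i) := by
        rcases lt_or_ge i a with h2 | h2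
        · rw [Nat.choose_eq_zero_of_lt (show d - a < d - i by omega),
            Nat.choose_eq_zero_of_lt (show s - a < s - i by omega)]
          simp
        · rw [Nat.choose_mul (by omega)]
          congr 2 <;> omega
      have h2 : ((d - a).choose (d - i) : ℤ) * ((d - i).choose (d - s) : ℤ) =
          ((d - a).choose (d - s) : ℤ) * ((s - a).choose (s - i) : ℤ) := by exact_mod_cast h1
      linear_combination (-1 : ℤ) ^ (s - i) * h2
    have hr := Finset.sum_range_reflect (fun j => (-1 : ℤ) ^ j * ((s - a).choose j : ℤ)) (s + 1)
    simp only [Nat.add_sub_cancel] at hr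
    rw [Finset.sum_congr rfl key, ← Finset.mul_sum, hr]
    have h3 : ∑ j ∈ Finset.range (s + 1), (-1 : ℤ) ^ j * ((s - a).choose j : ℤ) =
        ∑ j ∈ Finset.range (s - a + 1), (-1 : ℤ) ^ j * ((s - a).choose j : ℤ) := by
      symm
      apply Finset.sum_subset
      · intro x; simp only [Finset.mem_range]; omega
      · intro x _ hx
        rw [Nat.choose_eq_zero_of_lt (by simpa using hx)]
        simp
    rw [h3, Int.alternating_sum_range_choose]
    rcases h.eq_or_lt with rfl | h4
    · simp
    · rw [if_neg (by omega), if_neg (by omega), mul_zero]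

/-- By the orthogonality relation above, each `x` contributes its weight to the single entry `h_{δ
x}`. -/
theorem hNum_eq_sum_of_fNum_eq {ι α : Type*} [Fintype α] (K : PreAbstractSimplicialComplex ι)
    (d : ℕ) (g : α → ℤ) (δ : α → ℕ) (hd : rank K = d) (hδ : ∀ x, δ x ≤ d)
    (hf : ∀ m ≤ d, (fNum K m : ℤ) = ∑ x, g x * ((d - δ x).choose (d - m) : ℤ))
    (s : ℕ) (hs : s ≤ d) : hNum K s = ∑ x with δ x = s, g x := by
  rw [hNum, hd, if_pos hs]
  have : ∀ i ∈ Finset.range (s + 1),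
      (-1 : ℤ) ^ (s - i) * ((d - i).choose (d - s) : ℤ) * (fNum K i : ℤ) =
      ∑ x, g x * ((-1 : ℤ) ^ (s - i) * ((d - i).choose (d - s) : ℤ) *
        ((d - δ x).choose (d - i) : ℤ)) := by
    intro i hi
    rw [hf i (by have := Finset.mem_range.mp hi; omega), Finset.mul_sum]
    exact Finset.sum_congr rfl fun x _ => by ring
  rw [Finset.sum_congr rfl this, Finset.sum_comm, Finset.sum_filter]
  refine Finset.sum_congr rfl fun x _ => ?_
  rw [← Finset.mul_sum, sum_neg_one_pow_mul_choose_mul_choose (hδ x) hs]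
  simp

/-! ### Permutations: descents and initial part -/

/-- The initial segment `{0, …, t - 1}` of `Fin k`. -/
def initSeg (k t : ℕ) : Finset (Fin k) := Finset.univ.filter fun i => (i : ℕ) < t

@[simp] theorem mem_initSeg {k t : ℕ} {i : Fin k} : i ∈ initSeg k t ↔ (i : ℕ) < t := by
  simp [initSeg]

theorem card_initSeg {k t : ℕ} (h : t ≤ k) : (initSeg k t).card = t := by
  rw [initSeg, Fin.card_filter_val_lt, min_eq_right h]

theorem initSeg_mono (k : ℕ) : Monotone (initSeg k) := fun a b h i => by
  simp only [mem_initSeg]; omega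

theorem eq_initSeg_of_isLowerSet {k : ℕ} {B : Finset (Fin k)}
    (h : ∀ a ∈ B, ∀ b, b < a → b ∈ B) : B = initSeg k B.card := by
  have hle : B.card ≤ k := by simpa using Finset.card_le_univ B
  have hsub : B ⊆ initSeg k B.card := by
    intro a ha
    have : initSeg k (a + 1) ⊆ B := by
      intro b hb
      rcases (Nat.lt_succ_iff.mp (mem_initSeg.mp hb)).lt_or_eq with h1 | h1
      · exact h a ha b h1
      · rwa [Fin.ext h1]
    have := Finset.card_le_card this
    rw [card_initSeg a.2] at this
    simpa using this
  exact Finset.eq_of_subset_of_card_le hsub (by rw [card_initSeg hle])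

/-- The descent set of `π`, as a set of numbers between `1` and `k - 1`. -/
def descSet {k : ℕ} (π : Equiv.Perm (Fin k)) : Finset ℕ :=
  (Finset.univ.filter fun i : Fin k => ∃ j : Fin k, (i : ℕ) + 1 = j ∧ π j < π i).image
    fun i : Fin k => (i : ℕ) + 1

theorem card_descSet {k : ℕ} (π : Equiv.Perm (Fin k)) : (descSet π).card = des π := by
  rw [descSet, Finset.card_image_of_injective _ (fun a b h => by
    apply Fin.ext; simpa using h), des, Set.ncard_eq_toFinset_card']
  simp

theorem descSet_subset {k : ℕ} (π : Equiv.Perm (Fin k)) :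
    descSet π ⊆ Finset.Icc 1 (k - 1) := by
  intro a ha
  simp only [descSet, Finset.mem_image, Finset.mem_filter, Finset.mem_univ, true_and] at ha
  obtain ⟨i, ⟨j, hj, -⟩, rfl⟩ := ha
  have := j.2
  simp only [Finset.mem_Icc]; omega

theorem des_le {k : ℕ} (π : Equiv.Perm (Fin k)) : des π ≤ k - 1 := by
  rw [← card_descSet]
  simpa using Finset.card_le_card (descSet_subset π)

/-- If `π` has no descent between the positions `a < b`, then `π a < π b`. -/
theorem lt_of_forall_notMem_descSet {k : ℕ} (π : Equiv.Perm (Fin k)) {a b : Fin k} (hab : a < b)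
    (h : ∀ d ∈ descSet π, ¬ ((a : ℕ) < d ∧ d ≤ b)) : π a < π b := by
  have main : ∀ m : ℕ, ∀ b : Fin k, (b : ℕ) = a + (m + 1) →
      (∀ d ∈ descSet π, ¬ ((a : ℕ) < d ∧ d ≤ b)) → π a < π b := by
    have step : ∀ i j : Fin k, (i : ℕ) + 1 = j → (j : ℕ) ∉ descSet π → π i < π j := by
      intro i j hij hj
      by_contra hlt
      have hne : π j ≠ π i := fun h => by
        have := congrArg Fin.val (π.injective h); omega
      refine hj ?_
      simp only [descSet, Finset.mem_image, Finset.mem_filter, Finset.mem_univ, true_and]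
      exact ⟨i, ⟨j, hij, lt_of_le_of_ne (not_lt.mp hlt) hne⟩, hij⟩
    intro m
    induction m with
    | zero => exact fun b hb hd => step a b (by omega) fun hm => hd _ hm ⟨by omega, le_rfl⟩
    | succ m ih =>
      intro b hb hd
      have hc : (a : ℕ) + (m + 1) < k := by have := b.2; omega
      refine (ih ⟨a + (m + 1), hc⟩ rfl fun d hm hlt => hd d hm ⟨hlt.1, ?_⟩).trans
        (step _ b (by simp; omega) fun hm => hd _ hm ⟨by omega, le_rfl⟩)
      have := hlt.2
      simp only at this
      omega
  have hlt : (a : ℕ) < b := hab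
  exact main (b - a - 1) b (by omega) h

theorem image_initSeg_eq_iff {k : ℕ} (π : Equiv.Perm (Fin k)) (t : ℕ) :
    (π '' {i : Fin k | (i : ℕ) < t} = {i : Fin k | (i : ℕ) < t}) ↔
      (initSeg k t).image π = initSeg k t := by
  rw [← Finset.coe_inj]
  simp [initSeg]

theorem init_mem {k : ℕ} (hk : 1 ≤ k) (π : Equiv.Perm (Fin k)) :
    1 ≤ init π ∧ init π ≤ k ∧ (initSeg k (init π)).image π = initSeg k (init π) := by
  have hne : {t | 1 ≤ t ∧ t ≤ k ∧
      π '' {i : Fin k | (i : ℕ) < t} = {i : Fin k | (i : ℕ) < t}}.Nonempty :=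
    ⟨k, hk, le_rfl, by simp⟩
  have := Nat.sInf_mem hne
  rw [← image_initSeg_eq_iff]
  exact this

theorem init_le {k t : ℕ} (π : Equiv.Perm (Fin k)) (h1 : 1 ≤ t) (h2 : t ≤ k)
    (h : (initSeg k t).image π = initSeg k t) : init π ≤ t :=
  Nat.sInf_le ⟨h1, h2, (image_initSeg_eq_iff π t).2 h⟩

theorem lt_init_iff {k i : ℕ} (hi : i < k) (π : Equiv.Perm (Fin k)) :
    i < init π ↔ ∀ t, 1 ≤ t → t ≤ i → (initSeg k t).image π ≠ initSeg k t := by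
  constructor
  · intro h t h1 h2 h3
    have := init_le π h1 (by omega) h3
    omega
  · intro h
    by_contra hle
    obtain ⟨h1, -, h3⟩ := init_mem (by omega) π
    exact h _ h1 (by omega) h3

/-! ### Chains of subsets and permutations -/

variable {k : ℕ}

/-- A finite set of subsets of `Fin k` that is a chain under inclusion. -/
def IsFlag (c : Finset (Finset (Fin k))) : Prop :=
  IsChain (fun s t : Finset (Fin k) => s ⊆ t) (c : Set (Finset (Fin k)))

theorem IsFlag.total {c : Finset (Finset (Fin k))} (hc : IsFlag c) {A B : Finset (Fin k)}
    (hA : A ∈ c) (hB : B ∈ c) : A ⊆ B ∨ B ⊆ A := by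
  by_cases h : A = B
  · exact Or.inl h.le
  · exact hc hA hB h

/-- The number of members of `c` that avoid `l`. -/
def avoidCount (c : Finset (Finset (Fin k))) (l : Fin k) : ℕ := (c.filter fun A => l ∉ A).card

/-- The permutation that lists the blocks of the ordered set partition given by the chain `c`, each
block in increasing order. -/
def flagPerm (c : Finset (Finset (Fin k))) : Equiv.Perm (Fin k) := Tuple.sort (avoidCount c)

/-- `Tuple.sort` is the stable sort: blocks are the level sets of `avoidCount`, and ties are listed
by increasing letter. -/
theorem flagPerm_spec (c : Finset (Finset (Fin k))) :
    Monotone (avoidCount c ∘ flagPerm c) ∧ ∀ i j, i < j →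
      avoidCount c (flagPerm c i) = avoidCount c (flagPerm c j) → flagPerm c i < flagPerm c j :=
  Tuple.eq_sort_iff.1 rfl

/-- The chain of the images of the initial segments with lengths in `D`. -/
def flagOf (π : Equiv.Perm (Fin k)) (D : Finset ℕ) : Finset (Finset (Fin k)) :=
  D.image fun d => (initSeg k d).image π

theorem card_image_initSeg (π : Equiv.Perm (Fin k)) {d : ℕ} (hd : d ≤ k) :
    ((initSeg k d).image π).card = d := by
  rw [Finset.card_image_of_injective _ π.injective, card_initSeg hd]

theorem flagOf_injOn (π : Equiv.Perm (Fin k)) :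
    Set.InjOn (fun d => (initSeg k d).image π) {d | d ≤ k} := fun a ha b hb h => by
  have := congrArg Finset.card h
  simp only at this
  rwa [card_image_initSeg π ha, card_image_initSeg π hb] at this

theorem card_flagOf (π : Equiv.Perm (Fin k)) {D : Finset ℕ} (hD : ∀ d ∈ D, d ≤ k) :
    (flagOf π D).card = D.card :=
  Finset.card_image_of_injOn ((flagOf_injOn π).mono hD)

theorem image_card_flagOf (π : Equiv.Perm (Fin k)) {D : Finset ℕ} (hD : ∀ d ∈ D, d ≤ k) :
    (flagOf π D).image Finset.card = D := by
  rw [flagOf, Finset.image_image]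
  conv_rhs => rw [← Finset.image_id (s := D)]
  exact Finset.image_congr fun d hd => card_image_initSeg π (hD d hd)

theorem isFlag_flagOf (π : Equiv.Perm (Fin k)) (D : Finset ℕ) : IsFlag (flagOf π D) := by
  intro A hA B hB _
  simp only [flagOf, Finset.coe_image, Set.mem_image] at hA hB
  obtain ⟨a, -, rfl⟩ := hA
  obtain ⟨b, -, rfl⟩ := hB
  rcases le_total a b with h | h
  · exact Or.inl (Finset.image_subset_image (initSeg_mono k h))
  · exact Or.inr (Finset.image_subset_image (initSeg_mono k h))

theorem avoidCount_flagOf (π : Equiv.Perm (Fin k)) {D : Finset ℕ} (hD : ∀ d ∈ D, d ≤ k)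
    (p : Fin k) : avoidCount (flagOf π D) (π p) = (D.filter fun d => d ≤ (p : ℕ)).card := by
  rw [avoidCount, flagOf, Finset.filter_image, Finset.card_image_of_injOn]
  · congr 1
    ext d
    simp
  · exact (flagOf_injOn π).mono fun d hd => hD d (Finset.mem_filter.mp hd).1

/-- Between consecutive cuts in `D` the word of `π` increases, so `π` meets the characterization of
the stable sort. -/
theorem flagPerm_flagOf (π : Equiv.Perm (Fin k)) {D : Finset ℕ} (hD : ∀ d ∈ D, d ≤ k)
    (hπ : descSet π ⊆ D) : flagPerm (flagOf π D) = π := by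
  symm
  refine Tuple.eq_sort_iff.2 ⟨fun a b hab => ?_, fun a b hab h => ?_⟩
  · simp only [Function.comp_apply, avoidCount_flagOf π hD]
    refine Finset.card_le_card fun d => ?_
    have : (a : ℕ) ≤ b := hab
    simp only [Finset.mem_filter]
    exact fun h => ⟨h.1, h.2.trans this⟩
  · simp only [avoidCount_flagOf π hD] at h
    refine lt_of_forall_notMem_descSet π hab fun d hd hlt => ?_
    have hlt' : (a : ℕ) < b := hab
    refine absurd h (ne_of_lt (Finset.card_lt_card ?_))
    rw [Finset.ssubset_iff_of_subset]
    · refine ⟨d, ?_, ?_⟩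
      · simp only [Finset.mem_filter]; exact ⟨hπ hd, hlt.2⟩
      · simp only [Finset.mem_filter]; omega
    · intro e
      simp only [Finset.mem_filter]
      exact fun h => ⟨h.1, by omega⟩

/-- If `B` is comparable with all members of `c`, then its letters form an initial part of the word
of `flagPerm c`, provided that no block of `c` has a letter outside `B` before one inside `B`. -/
theorem image_flagPerm_of_comparable {c : Finset (Finset (Fin k))} {B : Finset (Fin k)}
    (hB : ∀ A ∈ c, A ⊆ B ∨ B ⊆ A)
    (h : ∀ x ∉ B, ∀ y ∈ B, x < y → avoidCount c x ≠ avoidCount c y) :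
    (initSeg k B.card).image (flagPerm c) = B := by
  obtain ⟨h1, h2⟩ := flagPerm_spec c
  set σ := flagPerm c
  -- A letter outside `B` standing before `y ∈ B` would tie with `y`: sorting bounds its count
  -- above, comparability below. Stability then makes it smaller than `y`, which `h` forbids.
  have hlow : ∀ a ∈ B.image σ.symm, ∀ b, b < a → b ∈ B.image σ.symm := by
    intro a ha b hab
    obtain ⟨y, hy, rfl⟩ := Finset.mem_image.mp ha
    refine Finset.mem_image.mpr ⟨σ b, ?_, by simp⟩
    by_contra hb
    have hle : avoidCount c y ≤ avoidCount c (σ b) := by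
      refine Finset.card_le_card fun A => ?_
      simp only [Finset.mem_filter]
      refine fun hA => ⟨hA.1, fun hbA => ?_⟩
      rcases hB A hA.1 with h3 | h3
      · exact hb (h3 hbA)
      · exact hA.2 (h3 hy)
    have hge : avoidCount c (σ b) ≤ avoidCount c y := by
      have := h1 hab.le
      simpa using this
    have heq := le_antisymm hge hle
    have hlt := h2 b (σ.symm y) hab (by simpa using heq)
    rw [Equiv.apply_symm_apply] at hlt
    exact h _ hb _ hy hlt heq
  have := eq_initSeg_of_isLowerSet hlow
  rw [Finset.card_image_of_injective _ σ.symm.injective] at this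
  rw [← this, Finset.image_image]
  simp

theorem image_flagPerm_of_mem {c : Finset (Finset (Fin k))} (hc : IsFlag c) {B : Finset (Fin k)}
    (hB : B ∈ c) : (initSeg k B.card).image (flagPerm c) = B := by
  refine image_flagPerm_of_comparable (fun A hA => hc.total hA hB) fun x hx y hy _ => ?_
  refine (ne_of_lt (Finset.card_lt_card ?_)).symm
  rw [Finset.ssubset_iff_of_subset]
  · exact ⟨B, by simp [hB, hx], by simp [hy]⟩
  · intro A
    simp only [Finset.mem_filter]
    refine fun hA => ⟨hA.1, fun hxA => ?_⟩
    rcases hc.total hA.1 hB with h3 | h3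
    · exact hx (h3 hxA)
    · exact hA.2 (h3 hy)

theorem flagOf_flagPerm {c : Finset (Finset (Fin k))} (hc : IsFlag c) :
    flagOf (flagPerm c) (c.image Finset.card) = c := by
  rw [flagOf, Finset.image_image]
  conv_rhs => rw [← Finset.image_id (s := c)]
  exact Finset.image_congr fun B hB => image_flagPerm_of_mem hc hB

/-- A descent cannot occur inside a block, so some member of `c` contains the letter before it but
not the one after; being an initial part of the word, that member ends exactly there. -/
theorem descSet_flagPerm_subset {c : Finset (Finset (Fin k))} (hc : IsFlag c) :
    descSet (flagPerm c) ⊆ c.image Finset.card := by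
  obtain ⟨h1, h2⟩ := flagPerm_spec c
  intro d hd
  simp only [descSet, Finset.mem_image, Finset.mem_filter, Finset.mem_univ, true_and] at hd
  obtain ⟨i, ⟨j, hij, hlt⟩, rfl⟩ := hd
  have hij' : i < j := by rw [Fin.lt_def]; omega
  have hne : avoidCount c (flagPerm c i) ≠ avoidCount c (flagPerm c j) := fun h =>
    lt_asymm hlt (h2 i j hij' h)
  have hcard : avoidCount c (flagPerm c i) < avoidCount c (flagPerm c j) :=
    lt_of_le_of_ne (h1 hij'.le) hne
  obtain ⟨A, hA, hA'⟩ := Finset.exists_mem_notMem_of_card_lt_card hcard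
  simp only [Finset.mem_filter, not_and, not_not] at hA hA'
  have hi := hA' hA.1
  have hj := hA.2
  refine Finset.mem_image.mpr ⟨A, hA.1, ?_⟩
  rw [← image_flagPerm_of_mem hc hA.1] at hi hj
  simp only [Finset.mem_image, mem_initSeg, EmbeddingLike.apply_eq_iff_eq, exists_eq_right] at hi hj
  omega

/-- Letters outside an initial segment exceed those inside, so the proviso of
`image_flagPerm_of_comparable` is vacuous. Conversely, images of initial segments under one
permutation are nested. -/
theorem comparable_initSeg_iff {c : Finset (Finset (Fin k))} (hc : IsFlag c) {t : ℕ} (ht : t ≤ k) :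
    (∀ A ∈ c, A ⊆ initSeg k t ∨ initSeg k t ⊆ A) ↔
      (initSeg k t).image (flagPerm c) = initSeg k t := by
  constructor
  · intro h
    have := image_flagPerm_of_comparable h fun x hx y hy hlt => by
      simp only [mem_initSeg] at hx hy
      have : (x : ℕ) < y := hlt
      omega
    rwa [card_initSeg ht] at this
  · intro h A hA
    rw [← h, ← image_flagPerm_of_mem hc hA]
    rcases le_total A.card t with h | h
    · exact Or.inl (Finset.image_subset_image (initSeg_mono k h))
    · exact Or.inr (Finset.image_subset_image (initSeg_mono k h))

theorem card_filter_powerset_Icc {E S : Finset ℕ} (hES : E ⊆ S) {m : ℕ} (hm : m ≤ S.card) :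
    (S.powerset.filter fun D => E ⊆ D ∧ D.card = m).card =
      (S.card - E.card).choose (S.card - m) := by
  rw [← Finset.card_sdiff_of_subset hES, ← Finset.card_powersetCard]
  refine Finset.card_bij' (fun D _ => S \ D) (fun D _ => S \ D) ?_ ?_ ?_ ?_
  · intro D hD
    simp only [Finset.mem_filter, Finset.mem_powerset, Finset.mem_powersetCard] at hD ⊢
    refine ⟨Finset.sdiff_subset_sdiff le_rfl hD.2.1, ?_⟩
    rw [Finset.card_sdiff_of_subset hD.1, hD.2.2]
  · intro D hD
    simp only [Finset.mem_filter, Finset.mem_powerset, Finset.mem_powersetCard] at hD ⊢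
    refine ⟨Finset.sdiff_subset, ?_, ?_⟩
    · intro x hx
      refine Finset.mem_sdiff.mpr ⟨hES hx, fun h => ?_⟩
      exact (Finset.mem_sdiff.mp (hD.1 h)).2 hx
    · rw [Finset.card_sdiff_of_subset (hD.1.trans Finset.sdiff_subset), hD.2]
      omega
  · intro D hD
    simp only [Finset.mem_filter, Finset.mem_powerset] at hD
    exact Finset.sdiff_sdiff_eq_self hD.1
  · intro D hD
    simp only [Finset.mem_powersetCard] at hD
    exact Finset.sdiff_sdiff_eq_self (hD.1.trans Finset.sdiff_subset)

/-- The chains with `m` members, all of sizes in `S`, that cannot be refined by any of the initial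
segments `{0, …, t - 1}` with `1 ≤ t ≤ i`. -/
def flags (k : ℕ) (S : Finset ℕ) (i m : ℕ) : Set (Finset (Finset (Fin k))) :=
  {c | IsFlag c ∧ (∀ A ∈ c, A.card ∈ S) ∧ c.card = m ∧
    ∀ t, 1 ≤ t → t ≤ i → ¬ ∀ A ∈ c, A ⊆ initSeg k t ∨ initSeg k t ⊆ A}

theorem mem_flags {S : Finset ℕ} {i m : ℕ} {c : Finset (Finset (Fin k))} :
    c ∈ flags k S i m ↔ IsFlag c ∧ (∀ A ∈ c, A.card ∈ S) ∧ c.card = m ∧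
      ∀ t, 1 ≤ t → t ≤ i → ¬ ∀ A ∈ c, A ⊆ initSeg k t ∨ initSeg k t ⊆ A :=
  Iff.rfl

/-- Chains correspond to pairs `(π, D)` with `descSet π ⊆ D ⊆ S`. Taking `S = range k` admits the
empty subset and serves the stars; `S = Icc 1 (k - 1)` with `i = 0` serves the boundary. -/
theorem ncard_flags {S : Finset ℕ} (hS : Finset.Icc 1 (k - 1) ⊆ S) (hS' : S ⊆ Finset.range k)
    {i m : ℕ} (hi : i < k) (hm : m ≤ S.card) :
    (flags k S i m).ncard = ∑ π : Equiv.Perm (Fin k) with i < init π,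
      (S.card - des π).choose (S.card - m) := by
  classical
  have hle : ∀ D ⊆ S, ∀ d ∈ D, d ≤ k := fun D hD d hd =>
    (Finset.mem_range.mp (hS' (hD hd))).le
  have hfin : (flags k S i m).ncard = (Finset.univ.filter (· ∈ flags k S i m)).card := by
    rw [Set.ncard_eq_toFinset_card']
    congr 1
    ext; simp
  rw [hfin, Finset.card_eq_sum_card_fiberwise (f := flagPerm)
    (t := Finset.univ.filter fun π : Equiv.Perm (Fin k) => i < init π)]
  · refine Finset.sum_congr rfl fun π hπ => ?_
    simp only [Finset.mem_filter, Finset.mem_univ, true_and] at hπ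
    rw [← card_descSet, ← card_filter_powerset_Icc ((descSet_subset π).trans hS) hm]
    refine Finset.card_bij' (fun c _ => c.image Finset.card) (fun D _ => flagOf π D) ?_ ?_ ?_ ?_
    · intro c hc
      simp only [Finset.mem_filter, Finset.mem_univ, true_and, mem_flags] at hc
      obtain ⟨⟨hc, hcS, hcm, -⟩, rfl⟩ := hc
      have hsub : c.image Finset.card ⊆ S := Finset.image_subset_iff.mpr hcS
      simp only [Finset.mem_filter, Finset.mem_powerset]
      refine ⟨hsub, descSet_flagPerm_subset hc, ?_⟩
      rw [← card_flagOf (flagPerm c) (hle _ hsub), flagOf_flagPerm hc, hcm]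
    · intro D hD
      simp only [Finset.mem_filter, Finset.mem_powerset] at hD
      obtain ⟨hDS, hπD, hDm⟩ := hD
      have hperm := flagPerm_flagOf π (hle D hDS) hπD
      simp only [Finset.mem_filter, Finset.mem_univ, true_and, mem_flags]
      refine ⟨⟨isFlag_flagOf π D, ?_, by rw [card_flagOf π (hle D hDS), hDm], ?_⟩, hperm⟩
      · intro A hA
        obtain ⟨d, hd, rfl⟩ := Finset.mem_image.mp hA
        rw [card_image_initSeg π (hle D hDS d hd)]
        exact hDS hd
      · intro t h1 h2
        rw [comparable_initSeg_iff (isFlag_flagOf π D) (by omega), hperm]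
        exact (lt_init_iff hi π).1 hπ t h1 h2
    · intro c hc
      simp only [Finset.mem_filter, Finset.mem_univ, true_and, mem_flags] at hc
      obtain ⟨⟨hc, -⟩, rfl⟩ := hc
      exact flagOf_flagPerm hc
    · intro D hD
      simp only [Finset.mem_filter, Finset.mem_powerset] at hD
      exact image_card_flagOf π (hle D hD.1)
  · intro c hc
    simp only [Finset.coe_filter, Finset.mem_univ, true_and, Set.mem_ofPred_eq] at hc ⊢
    rw [mem_flags] at hc
    obtain ⟨hc, -, -, hct⟩ := hc
    refine (lt_init_iff hi _).2 fun t h1 h2 => ?_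
    rw [Ne, ← comparable_initSeg_iff hc (by omega)]
    exact hct t h1 h2

/-! ### The local structure of the edgewise subdivision at an interior vertex -/

/-- Two lattice points are adjacent if they differ by a `0`-`1`-vector, up to sign. -/
def Adj {ι : Type*} (x y : ι → ℤ) : Prop := (x ≤ y ∧ y ≤ x + 1) ∨ (y ≤ x ∧ x ≤ y + 1)

/-- A set of pairwise adjacent lattice points. -/
def IsClique {ι : Type*} (s : Finset (ι → ℤ)) : Prop := ∀ x ∈ s, ∀ y ∈ s, Adj x y

theorem Adj.symm {ι : Type*} {x y : ι → ℤ} (h : Adj x y) : Adj y x := Or.symm h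

theorem Adj.refl {ι : Type*} (x : ι → ℤ) : Adj x x :=
  Or.inl ⟨le_rfl, fun i => by simp⟩

theorem IsClique.mono {ι : Type*} {s t : Finset (ι → ℤ)} (h : IsClique t) (hst : s ⊆ t) :
    IsClique s := fun x hx y hy => h x (hst hx) y (hst hy)

theorem isClique_insert {ι : Type*} [DecidableEq (ι → ℤ)] {s : Finset (ι → ℤ)} {w : ι → ℤ} :
    IsClique (insert w s) ↔ IsClique s ∧ ∀ x ∈ s, Adj w x := by
  constructor
  · exact fun h => ⟨h.mono (Finset.subset_insert _ _), fun x hx =>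
      h w (Finset.mem_insert_self _ _) x (Finset.mem_insert_of_mem hx)⟩
  · rintro ⟨h1, h2⟩ x hx y hy
    rcases Finset.mem_insert.mp hx with hx' | hx' <;>
      rcases Finset.mem_insert.mp hy with hy' | hy'
    · rw [hx', hy']; exact Adj.refl _
    · rw [hx']; exact h2 y hy'
    · rw [hy']; exact (h2 x hx').symm
    · exact h1 x hx' y hy'

variable {q : ℕ}

theorem facetVertex_apply (u : Fin (k - 1) → ℤ) (π : Equiv.Perm (Fin (k - 1))) (j : ℕ)
    (c : Fin (k - 1)) :
    facetVertex k u π j c = u c + if k - 1 ≤ (π.symm c : ℕ) + j then 1 else 0 := by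
  rw [facetVertex, Pi.add_apply, Finset.sum_apply, Finset.sum_filter]
  congr 1
  rw [Finset.sum_eq_single (π.symm c)]
  · simp
  · intro b _ hb
    rw [Pi.single_eq_of_ne (fun h => hb (by simp [h]))]
    simp
  · simp

theorem facetVertex_one_apply (u : Fin (k - 1) → ℤ) (j : ℕ) (c : Fin (k - 1)) :
    facetVertex k u 1 j c = u c + if k - 1 ≤ (c : ℕ) + j then 1 else 0 :=
  facetVertex_apply u 1 j c

theorem isClique_F (u : Fin (k - 1) → ℤ) (π : Equiv.Perm (Fin (k - 1))) : IsClique (F k u π) := by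
  have key : ∀ a b : ℕ, a ≤ b → Adj (facetVertex k u π a) (facetVertex k u π b) := by
    refine fun a b hab => Or.inl ⟨fun c => ?_, fun c => ?_⟩
    · simp only [facetVertex_apply]
      split_ifs <;> omega
    · simp only [Pi.add_apply, Pi.one_apply, facetVertex_apply]
      split_ifs <;> omega
  intro x hx y hy
  obtain ⟨a, -, rfl⟩ := Finset.mem_image.mp hx
  obtain ⟨b, -, rfl⟩ := Finset.mem_image.mp hy
  rcases le_total a b with h | h
  · exact key a b h
  · exact (key b a h).symm

/-- The lattice points in the interior of `R k q`. -/
def IsInner (k q : ℕ) (w : Fin (k - 1) → ℤ) : Prop :=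
  StrictMono w ∧ ∀ c, 1 ≤ w c ∧ w c + 1 ≤ q

/-- Gaps between the coordinates of `w` are at least 1, and a 0-1-vector closes a gap by at most 1.
-/
theorem IsInner.monotone_of_adj {w x : Fin (k - 1) → ℤ} (hw : IsInner k q w) (h : Adj w x) :
    Monotone x := by
  intro a b hab
  rcases hab.eq_or_lt with rfl | hab
  · exact le_rfl
  have h1 := hw.1 hab
  rcases h with ⟨h2, h3⟩ | ⟨h2, h3⟩
  · have := h2 b; have := h3 a
    simp only [Pi.add_apply, Pi.one_apply] at *
    omega
  · have := h2 a; have := h3 b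
    simp only [Pi.add_apply, Pi.one_apply] at *
    omega

/-- The clique has a least element `u`, and the sets of coordinates that its points raise above `u`
form a chain. Sorting coordinates by how many points raise them puts the most often raised last,
where `F` adds unit vectors first; stability of the sort yields consistency. -/
theorem exists_isFacet_of_isClique (hk : 1 ≤ k) {w : Fin (k - 1) → ℤ} (hw : IsInner k q w)
    {s : Finset (Fin (k - 1) → ℤ)} (hws : w ∈ s) (hs : IsClique s) :
    ∃ u π, IsFacet k q u π ∧ s ⊆ F k u π := by
  obtain ⟨u, hu⟩ := s.exists_minimal ⟨w, hws⟩
  have hle : ∀ x ∈ s, u ≤ x ∧ x ≤ u + 1 := by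
    intro x hx
    rcases hs u hu.1 x hx with h | h
    · exact h
    · exact ⟨hu.2 hx h.1, h.1.trans fun c => by simp⟩
  set key : Fin (k - 1) → ℕ := fun c => (s.filter fun x => u c < x c).card with hkey
  set π : Equiv.Perm (Fin (k - 1)) := Tuple.sort key with hπ
  obtain ⟨hmono, hstab⟩ := Tuple.eq_sort_iff.1 hπ
  refine ⟨u, π, ⟨⟨fun c => ?_, hw.monotone_of_adj (hs w hws u hu.1), fun c => ?_⟩,
    ⟨fun c => ?_, fun a b hab => ?_, fun c => ?_⟩, ?_⟩, ?_⟩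
  · have h1 : w c ≤ u c + 1 := (hle w hws).2 c
    have h2 := hw.2 c
    omega
  · have h1 : u c ≤ w c := (hle w hws).1 c
    have h2 := hw.2 c
    omega
  · have h1 : w c ≤ u c + 1 := (hle w hws).2 c
    have h2 := hw.2 c
    simp only [Pi.add_apply, Pi.one_apply]
    omega
  · exact add_le_add_left (hw.monotone_of_adj (hs w hws u hu.1) hab) 1
  · have h1 : u c ≤ w c := (hle w hws).1 c
    have h2 := hw.2 c
    simp only [Pi.add_apply, Pi.one_apply]
    omega
  · intro a b hab huab
    have hab' : a < b := by rw [Fin.lt_def]; omega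
    by_contra hlt
    have hne : π.symm b ≠ π.symm a := fun h => hab'.ne' (π.symm.injective h)
    have hlt' : π.symm b < π.symm a := lt_of_le_of_ne (not_lt.mp hlt) hne
    have h1 : key b ≤ key a := by simpa using hmono hlt'.le
    have h2 : key a ≤ key b := by
      refine Finset.card_le_card fun x => ?_
      simp only [Finset.mem_filter]
      refine fun hx => ⟨hx.1, ?_⟩
      have := hw.monotone_of_adj (hs w hws x hx.1) hab'.le
      omega
    have h3 := hstab _ _ hlt' (by simpa using le_antisymm h1 h2)
    simp only [Equiv.apply_symm_apply] at h3
    exact lt_asymm h3 hab'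
  · intro x hx
    -- If `x` raises `π b` but not `y`, every point raising `y` lies above `x` and raises `π b` too,
    -- so `π b` has the strictly larger key and must stand after `y`.
    have hlow : ∀ a ∈ (Finset.univ.filter fun c => x c = u c).image π.symm, ∀ b, b < a →
        b ∈ (Finset.univ.filter fun c => x c = u c).image π.symm := by
      intro a ha b hba
      obtain ⟨y, hy, rfl⟩ := Finset.mem_image.mp ha
      simp only [Finset.mem_filter, Finset.mem_univ, true_and] at hy
      refine Finset.mem_image.mpr ⟨π b, ?_, by simp⟩
      simp only [Finset.mem_filter, Finset.mem_univ, true_and]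
      by_contra hne
      have hlt : u (π b) < x (π b) := lt_of_le_of_ne ((hle x hx).1 _) (Ne.symm hne)
      have h1 : key (π b) ≤ key y := by simpa using hmono hba.le
      refine absurd h1 (not_le.mpr (Finset.card_lt_card ?_))
      rw [Finset.ssubset_iff_of_subset]
      · exact ⟨x, by simp [hx, hlt], by simp [hy]⟩
      · intro z
        simp only [Finset.mem_filter]
        refine fun hz => ⟨hz.1, ?_⟩
        rcases hs x hx z hz.1 with h | h
        · exact hlt.trans_le (h.1 _)
        · have : z y ≤ x y := h.1 y
          omega
    have hB := eq_initSeg_of_isLowerSet hlow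
    set b := ((Finset.univ.filter fun c => x c = u c).image π.symm).card
    have hmem : ∀ c, x c = u c ↔ (π.symm c : ℕ) < b := by
      intro c
      rw [← mem_initSeg, ← hB]
      simp
    have hb : b ≤ k - 1 := by
      simpa using Finset.card_le_univ ((Finset.univ.filter fun c => x c = u c).image π.symm)
    refine Finset.mem_image.mpr ⟨k - 1 - b, Finset.mem_range.mpr (by omega), ?_⟩
    ext c
    rw [facetVertex_apply]
    have h1 : u c ≤ x c := (hle x hx).1 c
    have h2 : x c ≤ u c + 1 := (hle x hx).2 c
    have h3 := hmem c
    split_ifs with h <;> omega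

theorem mem_star_T_iff (hk : 1 ≤ k) {w : Fin (k - 1) → ℤ} (hw : IsInner k q w)
    {ρ : Finset (Fin (k - 1) → ℤ)} :
    ρ ∈ (star (T k q) {w}).faces ↔ ρ.Nonempty ∧ IsClique (insert w ρ) := by
  constructor
  · rintro ⟨hρ, τ, ⟨-, u, π, -, hτ⟩, hwτ, hρτ⟩
    refine ⟨hρ, (isClique_F u π).mono (Finset.insert_subset ?_ (hρτ.trans hτ))⟩
    exact hτ (hwτ (Finset.mem_singleton_self w))
  · rintro ⟨hρ, h⟩
    obtain ⟨u, π, h1, h2⟩ := exists_isFacet_of_isClique hk hw (Finset.mem_insert_self w ρ) h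
    exact ⟨hρ, insert w ρ, ⟨Finset.insert_nonempty _ _, u, π, h1, h2⟩, by simp,
      Finset.subset_insert _ _⟩

/-! ### The interior of `R k q` -/

theorem isInner_facetVertex_of_interior {v : Fin (k - 1) → ℤ}
    (hint : ∀ w ∈ F k v 1, (fun i => (w i : ℝ)) ∈ interior (R k q)) {j : ℕ}
    (hj : j < k) : IsInner k q (facetVertex k v 1 j) := by
  set w := facetVertex k v 1 j with hw
  have hmem := hint w (Finset.mem_image.mpr ⟨j, Finset.mem_range.mpr hj, rfl⟩)
  have key : ∀ d : Fin (k - 1) → ℝ, ∃ ε > (0 : ℝ), (fun i => (w i : ℝ)) + ε • d ∈ R k q := by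
    intro d
    have hcont : Filter.Tendsto (fun ε : ℝ => (fun i => (w i : ℝ)) + ε • d) (nhds 0)
        (nhds (fun i => (w i : ℝ))) := by
      have : Continuous fun ε : ℝ => (fun i => (w i : ℝ)) + ε • d := by fun_prop
      simpa using this.tendsto 0
    have h1 := hcont.eventually (isOpen_interior.mem_nhds hmem)
    have h2 : ∀ᶠ ε : ℝ in nhdsWithin 0 (Set.Ioi 0),
        (fun i => (w i : ℝ)) + ε • d ∈ interior (R k q) := h1.filter_mono nhdsWithin_le_nhds
    obtain ⟨ε, h3, h4⟩ := (h2.and self_mem_nhdsWithin).exists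
    exact ⟨ε, h4, interior_subset h3⟩
  refine ⟨fun a b hab => ?_, fun c => ⟨?_, ?_⟩⟩
  -- This direction shrinks every gap, so staying in `R k q` forces the gaps of `w` to be positive.
  · obtain ⟨ε, hε, -, h, -⟩ := key fun c => -(c : ℝ)
    have h1 := h hab.le
    simp only [Pi.add_apply, Pi.smul_apply, smul_eq_mul] at h1
    have h2 : (a : ℝ) < (b : ℝ) := by exact_mod_cast hab
    have h3 : (w a : ℝ) < w b := by nlinarith
    exact_mod_cast h3
  · obtain ⟨ε, hε, h, -, -⟩ := key fun _ => -1
    have h1 := h c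
    simp only [Pi.add_apply, Pi.smul_apply, smul_eq_mul] at h1
    have h3 : (0 : ℝ) < w c := by linarith
    have h4 : (0 : ℤ) < w c := by exact_mod_cast h3
    omega
  · obtain ⟨ε, hε, -, -, h⟩ := key fun _ => 1
    have h1 := h c
    simp only [Pi.add_apply, Pi.smul_apply, smul_eq_mul] at h1
    have h3 : (w c : ℝ) < q := by linarith
    have h4 : w c < (q : ℤ) := by exact_mod_cast h3
    omega

/-! ### Neighbours of a vertex as subsets -/

/-- The letter `c + i + 1` modulo `k`: this labels the coordinates by the letters other than `i`. -/
def letter (i : Fin k) (c : Fin (k - 1)) : Fin k :=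
  ⟨if (c : ℕ) + i + 1 < k then c + i + 1 else c + i + 1 - k, by
    have := c.2; have := i.2; split_ifs <;> omega⟩

theorem letter_ne (i : Fin k) (c : Fin (k - 1)) : letter i c ≠ i := by
  intro h
  have h1 := congrArg Fin.val h
  have := c.2; have := i.2
  simp only [letter] at h1
  split_ifs at h1 <;> omega

theorem letter_injective (i : Fin k) : Function.Injective (letter i) := by
  intro c d h
  have h1 := congrArg Fin.val h
  have := c.2; have := d.2; have := i.2
  simp only [letter] at h1
  apply Fin.ext
  split_ifs at h1 <;> omega

theorem exists_letter_eq {i l : Fin k} (h : l ≠ i) : ∃ c, letter i c = l := by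
  have h1 : (l : ℕ) ≠ i := fun h' => h (Fin.ext h')
  have := l.2; have := i.2
  refine ⟨⟨if (i : ℕ) < l then l - i - 1 else l + k - i - 1, by split_ifs <;> omega⟩, ?_⟩
  apply Fin.ext
  simp only [letter]
  split_ifs <;> omega

/-- The lattice point obtained from `w` by subtracting the unit vectors whose letters are in `A`,
and adding `(1, …, 1)` if `i ∈ A`. -/
def nbr (w : Fin (k - 1) → ℤ) (i : Fin k) (A : Finset (Fin k)) : Fin (k - 1) → ℤ := fun c =>
  w c + (if i ∈ A then 1 else 0) - (if letter i c ∈ A then 1 else 0)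

theorem nbr_empty (w : Fin (k - 1) → ℤ) (i : Fin k) : nbr w i ∅ = w := by
  ext c; simp [nbr]

/-- Enlarging `A` to `B` lowers coordinates, unless `i` joins the set: then the added all-ones
vector turns the lowering into a raising. -/
theorem adj_nbr_of_subset (w : Fin (k - 1) → ℤ) (i : Fin k) {A B : Finset (Fin k)} (h : A ⊆ B) :
    Adj (nbr w i A) (nbr w i B) := by
  by_cases hi : i ∈ B ∧ i ∉ A
  · refine Or.inl ⟨fun c => ?_, fun c => ?_⟩ <;>
    · have := @h (letter i c)
      simp only [nbr, Pi.add_apply, Pi.one_apply, hi.1, hi.2]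
      split_ifs <;> first | omega | tauto
  · have hi' : i ∈ A ↔ i ∈ B := ⟨fun h' => h h', by tauto⟩
    refine Or.inr ⟨fun c => ?_, fun c => ?_⟩ <;>
    · have := @h (letter i c)
      simp only [nbr, Pi.add_apply, Pi.one_apply, hi']
      split_ifs <;> first | omega | tauto

theorem adj_nbr_iff (w : Fin (k - 1) → ℤ) (i : Fin k) {A B : Finset (Fin k)} :
    Adj (nbr w i A) (nbr w i B) ↔ A ⊆ B ∨ B ⊆ A := by
  constructor
  · have key : ∀ A B : Finset (Fin k), nbr w i A ≤ nbr w i B → nbr w i B ≤ nbr w i A + 1 →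
        A ⊆ B ∨ B ⊆ A := by
      intro A B h1 h2
      by_contra! h
      obtain ⟨l, hlA, hlB⟩ := Finset.not_subset.mp h.1
      obtain ⟨m, hmB, hmA⟩ := Finset.not_subset.mp h.2
      have hi : i ∈ B → i ∈ A := fun hiB => by
        by_contra hiA
        obtain ⟨c, rfl⟩ := exists_letter_eq (i := i) (l := l) (by rintro rfl; exact hiA hlA)
        have h3 := h2 c
        simp only [nbr, Pi.add_apply, Pi.one_apply, hlA, hlB, hiA, hiB, if_true, if_false] at h3
        omega
      by_cases hmi : m = i
      · subst hmi; exact hmA (hi hmB)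
      · obtain ⟨c, rfl⟩ := exists_letter_eq hmi
        have h3 := h1 c
        simp only [nbr, hmA, hmB, if_true, if_false] at h3
        split_ifs at h3 <;> first | omega | tauto
    rintro (h | h)
    · exact key A B h.1 h.2
    · exact (key B A h.1 h.2).symm
  · rintro (h | h)
    · exact adj_nbr_of_subset w i h
    · exact (adj_nbr_of_subset w i h).symm

/-- The full set must be left out, since it yields `w`, as `∅` does. -/
theorem nbr_injOn (w : Fin (k - 1) → ℤ) (i : Fin k) :
    Set.InjOn (nbr w i) {A | A ≠ Finset.univ} := by
  have key : ∀ A B : Finset (Fin k), A ≠ Finset.univ → nbr w i A = nbr w i B → A ⊆ B := by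
    intro A B hA h l hlA
    by_contra hlB
    have hi : i ∈ A ∧ i ∉ B := by
      by_cases hl : l = i
      · subst hl; exact ⟨hlA, hlB⟩
      · obtain ⟨c, rfl⟩ := exists_letter_eq hl
        have := congrFun h c
        simp only [nbr, hlA, hlB] at this
        constructor <;> by_contra hi <;> split_ifs at this <;> omega
    refine hA (Finset.eq_univ_iff_forall.mpr fun l' => ?_)
    by_contra hl'
    have hne : l' ≠ i := by rintro rfl; exact hl' hi.1
    obtain ⟨c, rfl⟩ := exists_letter_eq hne
    have := congrFun h c
    simp only [nbr, hi.1, hi.2, hl'] at this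
    split_ifs at this <;> omega
  exact fun A hA B hB h => (key A B hA h).antisymm (key B A hB h.symm)

theorem exists_nbr_eq {w x : Fin (k - 1) → ℤ} (i : Fin k) (h : Adj w x) :
    ∃ A, A ≠ Finset.univ ∧ nbr w i A = x := by
  classical
  -- Below `w`, the set consists of the lowered letters and omits `i`; otherwise it consists of `i`
  -- and the letters left unchanged.
  by_cases hx : x ≤ w
  · have hx' : w ≤ x + 1 := by
      rcases h with h | h
      · exact h.1.trans fun c => by simp
      · exact h.2
    have hi : i ∉ Finset.univ.filter fun l => ∃ c, letter i c = l ∧ x c < w c := by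
      simp only [Finset.mem_filter, Finset.mem_univ, true_and, not_exists, not_and]
      exact fun c hc => absurd hc (letter_ne i c)
    refine ⟨Finset.univ.filter fun l => ∃ c, letter i c = l ∧ x c < w c, fun h => hi (by simp [h]),
      ?_⟩
    ext c
    have h1 : x c ≤ w c := hx c
    have h2 : w c ≤ x c + 1 := hx' c
    simp only [nbr, hi, Finset.mem_filter, Finset.mem_univ, true_and, if_false,
      (letter_injective i).eq_iff, exists_eq_left]
    split_ifs <;> omega
  · have hwx : w ≤ x ∧ x ≤ w + 1 := h.resolve_right fun h => hx h.1
    have hi : i ∈ Finset.univ.filter fun l => ∀ c, letter i c = l → x c = w c := by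
      simp only [Finset.mem_filter, Finset.mem_univ, true_and]
      exact fun c hc => absurd hc (letter_ne i c)
    refine ⟨Finset.univ.filter fun l => ∀ c, letter i c = l → x c = w c, fun h => hx ?_, ?_⟩
    · intro c
      have := Finset.eq_univ_iff_forall.mp h (letter i c)
      simp only [Finset.mem_filter, Finset.mem_univ, true_and] at this
      exact (this c rfl).le
    · ext c
      have h1 : w c ≤ x c := hwx.1 c
      have h2 : x c ≤ w c + 1 := hwx.2 c
      simp only [nbr, hi, Finset.mem_filter, Finset.mem_univ, true_and, if_true,
        (letter_injective i).eq_iff, forall_eq]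
      split_ifs <;> omega

/-- This is what the cyclic shift in `letter` is for: the last `t` coordinates raised on the way to
vertex `i` receive the letters `0, …, t - 1`. -/
theorem nbr_initSeg (v : Fin (k - 1) → ℤ) (i : Fin k) {t : ℕ} (ht : t ≤ i) :
    nbr (facetVertex k v 1 i) i (initSeg k t) = facetVertex k v 1 (i - t) := by
  ext c
  have := c.2; have := i.2
  have hi : i ∉ initSeg k t := by simpa using ht
  have hc : letter i c ∈ initSeg k t ↔ k ≤ (c : ℕ) + i + 1 ∧ (c : ℕ) + i + 1 < k + t := by
    simp only [letter, mem_initSeg]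
    split_ifs <;> omega
  simp only [nbr, facetVertex_one_apply, hi, hc, if_false]
  split_ifs <;> omega

/-! ### Counting the faces of the star cluster -/

/-- The sets of `m` vertices in the star of the `i`-th vertex of `F(v, Id)`, but not in the star of
an earlier vertex (the empty set is in all the stars). -/
def newFaces (k : ℕ) (v : Fin (k - 1) → ℤ) (m : ℕ) (i : Fin k) :
    Set (Finset (Fin (k - 1) → ℤ)) :=
  {ρ | ρ.card = m ∧ IsClique (insert (facetVertex k v 1 i) ρ) ∧
    ∀ j < (i : ℕ), ¬ IsClique (insert (facetVertex k v 1 j) ρ)}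

theorem mem_newFaces {v : Fin (k - 1) → ℤ} {m : ℕ} {i : Fin k} {ρ : Finset (Fin (k - 1) → ℤ)} :
    ρ ∈ newFaces k v m i ↔ ρ.card = m ∧ IsClique (insert (facetVertex k v 1 i) ρ) ∧
      ∀ j < (i : ℕ), ¬ IsClique (insert (facetVertex k v 1 j) ρ) :=
  Iff.rfl

theorem isClique_image_nbr_iff (w : Fin (k - 1) → ℤ) (i : Fin k) (c : Finset (Finset (Fin k))) :
    IsClique (c.image (nbr w i)) ↔ IsFlag c := by
  simp only [IsClique, Finset.forall_mem_image, adj_nbr_iff]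
  exact ⟨fun h A hA B hB _ => h hA hB, fun h A hA B hB => h.total hA hB⟩

theorem ne_univ_iff_card_mem_range {A : Finset (Fin k)} :
    A ≠ Finset.univ ↔ A.card ∈ Finset.range k := by
  have h1 := Finset.card_le_univ A
  have h2 := Finset.card_eq_iff_eq_univ A
  rw [Fintype.card_fin] at h1 h2
  rw [Finset.mem_range, Ne, ← h2]
  omega

theorem newFaces_eq_image (v : Fin (k - 1) → ℤ) (m : ℕ) (i : Fin k) :
    newFaces k v m i = (fun c : Finset (Finset (Fin k)) => c.image (nbr (facetVertex k v 1 i) i)) ''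
      flags k (Finset.range k) i m := by
  set w := facetVertex k v 1 i with hw
  have main : ∀ c : Finset (Finset (Fin k)), (∀ A ∈ c, A.card ∈ Finset.range k) →
      (c.image (nbr w i) ∈ newFaces k v m i ↔ c ∈ flags k (Finset.range k) i m) := by
    intro c hc
    have hinj : Set.InjOn (nbr w i) c := (nbr_injOn w i).mono fun A hA =>
      ne_univ_iff_card_mem_range.mpr (hc A hA)
    -- Since `w` is the image of `∅`, which is comparable with everything, inserting it imposes no
    -- condition.
    have hins : IsClique (insert w (c.image (nbr w i))) ↔ IsFlag c := by
      rw [isClique_insert, isClique_image_nbr_iff, Finset.forall_mem_image]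
      refine and_iff_left fun A _ => ?_
      conv => enter [1]; rw [← nbr_empty w i]
      exact adj_nbr_of_subset w i (Finset.empty_subset A)
    rw [mem_newFaces, mem_flags, Finset.card_image_of_injOn hinj, ← hw, hins]
    have hcmp : IsFlag c → ∀ t ≤ (i : ℕ),
        (IsClique (insert (facetVertex k v 1 (i - t)) (c.image (nbr w i))) ↔
          ∀ A ∈ c, A ⊆ initSeg k t ∨ initSeg k t ⊆ A) := by
      intro hfl t ht
      rw [isClique_insert, isClique_image_nbr_iff, and_iff_right hfl, Finset.forall_mem_image,
        ← nbr_initSeg v i ht]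
      refine forall₂_congr fun A _ => ?_
      rw [adj_nbr_iff, or_comm]
    constructor
    · rintro ⟨h1, h2, h3⟩
      refine ⟨h2, hc, h1, fun t ht ht' => ?_⟩
      rw [← hcmp h2 t ht']
      exact h3 _ (by omega)
    · rintro ⟨h2, -, h1, h3⟩
      refine ⟨h1, h2, fun j hj => ?_⟩
      have h4 := h3 (i - j) (by omega) (by omega)
      rw [← hcmp h2 _ (by omega)] at h4
      rwa [show (i : ℕ) - (i - j) = j by omega] at h4
  ext ρ
  constructor
  · intro hρ
    have hadj := (isClique_insert.mp hρ.2.1).2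
    choose! f hf using fun x hx => exists_nbr_eq i (hadj x hx)
    have hcard : ∀ A ∈ ρ.image f, A.card ∈ Finset.range k := by
      rw [Finset.forall_mem_image]
      exact fun x hx => ne_univ_iff_card_mem_range.mp (hf x hx).1
    have himg : (ρ.image f).image (nbr w i) = ρ := by
      rw [Finset.image_image]
      conv_rhs => rw [← Finset.image_id (s := ρ)]
      exact Finset.image_congr fun x hx => (hf x hx).2
    exact ⟨ρ.image f, (main _ hcard).1 (by rwa [himg]), himg⟩
  · rintro ⟨c, hc, rfl⟩
    exact (main c hc.2.1).2 hc

theorem newFaces_finite (v : Fin (k - 1) → ℤ) (m : ℕ) (i : Fin k) : (newFaces k v m i).Finite := by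
  rw [newFaces_eq_image]
  exact (Set.toFinite _).image _

theorem ncard_newFaces (v : Fin (k - 1) → ℤ) {m : ℕ} (hm : m ≤ k) (i : Fin k) :
    (newFaces k v m i).ncard =
      ∑ π : Equiv.Perm (Fin k) with (i : ℕ) < init π, (k - des π).choose (k - m) := by
  rw [newFaces_eq_image, Set.InjOn.ncard_image, ncard_flags (fun x => by
    simp only [Finset.mem_Icc, Finset.mem_range]; have := i.2; omega) le_rfl i.2 (by simpa using hm)]
  · simp
  · intro c hc c' hc' h
    have h1 : ∀ c ∈ flags k (Finset.range k) i m,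
        (c : Set (Finset (Fin k))) ⊆ {A | A ≠ Finset.univ} := fun c hc A hA =>
      ne_univ_iff_card_mem_range.mpr (hc.2.1 A hA)
    have h2 := congrArg (fun s : Finset (Fin (k - 1) → ℤ) => (s : Set (Fin (k - 1) → ℤ))) h
    simp only [Finset.coe_image] at h2
    exact Finset.coe_injective
      (((nbr_injOn _ i).image_eq_image_iff (h1 c hc) (h1 c' hc')).mp h2)

/-- Each clique is filed under the first vertex whose star contains it; a permutation then
contributes for every `i < init π`. -/
theorem ncard_cliques (hk : 1 ≤ k) (v : Fin (k - 1) → ℤ) {m : ℕ} (hm : m ≤ k) :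
    Set.ncard {ρ : Finset (Fin (k - 1) → ℤ) | ρ.card = m ∧
      ∃ j < k, IsClique (insert (facetVertex k v 1 j) ρ)} =
      ∑ π : Equiv.Perm (Fin k), init π * (k - des π).choose (k - m) := by
  have hU : {ρ : Finset (Fin (k - 1) → ℤ) | ρ.card = m ∧
      ∃ j < k, IsClique (insert (facetVertex k v 1 j) ρ)} = ⋃ i, newFaces k v m i := by
    classical
    ext ρ
    rw [Set.mem_iUnion]
    constructor
    · rintro ⟨h1, h2⟩
      have h3 := Nat.find_spec h2
      refine ⟨⟨Nat.find h2, h3.1⟩, h1, h3.2, fun j hj h4 => ?_⟩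
      have hj' : j < Nat.find h2 := hj
      exact Nat.find_min h2 hj' ⟨hj'.trans h3.1, h4⟩
    · rintro ⟨i, h1, h2, -⟩
      exact ⟨h1, i, i.2, h2⟩
  have hdisj : Pairwise (Function.onFun Disjoint (newFaces k v m)) := by
    have key : ∀ i j : Fin k, i < j → Disjoint (newFaces k v m i) (newFaces k v m j) :=
      fun i j hij => Set.disjoint_left.mpr fun ρ h1 h2 => h2.2.2 i hij h1.2.1
    intro i j hij
    rcases lt_or_gt_of_ne hij with h | h
    · exact key i j h
    · exact (key j i h).symm
  rw [hU, Set.ncard_iUnion_of_finite (newFaces_finite v m) hdisj, finsum_eq_sum_of_fintype]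
  simp only [ncard_newFaces v hm, Finset.sum_filter]
  rw [Finset.sum_comm]
  refine Finset.sum_congr rfl fun π _ => ?_
  rw [← Finset.sum_filter, Finset.sum_const, smul_eq_mul, Fin.card_filter_val_lt,
    min_eq_right (init_mem hk π).2.1]

theorem mem_SC_iff (hk : 1 ≤ k) {v : Fin (k - 1) → ℤ}
    (hint : ∀ w ∈ F k v 1, (fun i => (w i : ℝ)) ∈ interior (R k q))
    {ρ : Finset (Fin (k - 1) → ℤ)} :
    ρ ∈ (SC k q v).faces ↔ ρ.Nonempty ∧
      ∃ j < k, IsClique (insert (facetVertex k v 1 j) ρ) := by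
  constructor
  · rintro ⟨w, hw, h⟩
    obtain ⟨j, hj, rfl⟩ := Finset.mem_image.mp hw
    have hj' := Finset.mem_range.mp hj
    have := (mem_star_T_iff hk (isInner_facetVertex_of_interior hint hj')).1 h
    exact ⟨this.1, j, hj', this.2⟩
  · rintro ⟨h, j, hj, hc⟩
    exact ⟨_, Finset.mem_image.mpr ⟨j, Finset.mem_range.mpr hj, rfl⟩,
      (mem_star_T_iff hk (isInner_facetVertex_of_interior hint hj)).2 ⟨h, hc⟩⟩

theorem fNum_SC (hk : 1 ≤ k) {v : Fin (k - 1) → ℤ}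
    (hint : ∀ w ∈ F k v 1, (fun i => (w i : ℝ)) ∈ interior (R k q)) {m : ℕ} (hm : m ≤ k) :
    fNum (SC k q v) m = ∑ π : Equiv.Perm (Fin k), init π * (k - des π).choose (k - m) := by
  rw [← ncard_cliques hk v hm, fNum]
  split_ifs with h
  · subst h
    symm
    rw [Set.ncard_eq_one]
    refine ⟨∅, Set.eq_singleton_iff_unique_mem.mpr ⟨⟨rfl, 0, hk, ?_⟩, fun ρ hρ => ?_⟩⟩
    · simp [IsClique, Adj.refl]
    · exact Finset.card_eq_zero.mp hρ.1
  · congr 1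
    ext ρ
    constructor
    · rintro ⟨h1, h2⟩
      exact ⟨h2, ((mem_SC_iff hk hint).1 h1).2⟩
    · rintro ⟨h1, h2⟩
      refine ⟨(mem_SC_iff hk hint).2 ⟨?_, h2⟩, h1⟩
      rw [← Finset.card_pos]
      omega

theorem rank_eq_of_forall_card_le {ι : Type*} {K : PreAbstractSimplicialComplex ι} {d : ℕ}
    (hle : ∀ s ∈ K.faces, s.card ≤ d) (hd : fNum K d ≠ 0) : rank K = d := by
  -- For `d = 0` the hypothesis `hd` holds by convention and supplies no face; the upper bound alone
  -- suffices.
  rcases Nat.eq_zero_or_pos d with rfl | hpos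
  · refine Nat.eq_zero_of_le_zero (csSup_le' ?_)
    rintro _ ⟨s, hs, rfl⟩
    exact hle s hs
  · rw [fNum, if_neg hpos.ne'] at hd
    obtain ⟨s, hs, hcard⟩ := Set.nonempty_of_ncard_ne_zero hd
    refine le_antisymm (csSup_le' ?_) (le_csSup ⟨d, ?_⟩ ⟨s, hs, hcard⟩) <;>
    · rintro _ ⟨s, hs, rfl⟩
      exact hle s hs

theorem rank_SC (hk : 1 ≤ k) {v : Fin (k - 1) → ℤ}
    (hint : ∀ w ∈ F k v 1, (fun i => (w i : ℝ)) ∈ interior (R k q)) :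
    rank (SC k q v) = k := by
  refine rank_eq_of_forall_card_le ?_ ?_
  · rintro ρ ⟨w, -, -, τ, ⟨-, u, π, -, hτ⟩, -, hρτ⟩
    refine (Finset.card_le_card (hρτ.trans hτ)).trans ?_
    exact Finset.card_image_le.trans (Finset.card_range k).le
  · rw [fNum_SC hk hint le_rfl]
    refine (Finset.sum_pos (fun π _ => ?_) ⟨1, Finset.mem_univ _⟩).ne'
    simpa using Nat.pos_of_ne_zero (Nat.one_le_iff_ne_zero.mp (init_mem hk π).1)

theorem hNum_SC (hk : 1 ≤ k) {v : Fin (k - 1) → ℤ}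
    (hint : ∀ w ∈ F k v 1, (fun i => (w i : ℝ)) ∈ interior (R k q)) {j : ℕ} (hj : j ≤ k) :
    hNum (SC k q v) j = ∑ π : Equiv.Perm (Fin k) with des π = j, (init π : ℤ) :=
  hNum_eq_sum_of_fNum_eq (SC k q v) k (fun π => (init π : ℤ)) des (rank_SC hk hint)
    (fun π => (des_le π).trans (Nat.sub_le k 1))
    (fun m hm => by rw [fNum_SC hk hint hm]; push_cast; rfl) j hj

/-! ### The barycentric subdivision of the boundary of the simplex -/

theorem mem_boundarySimplex_iff {A : Finset (Fin k)} :
    A ∈ (boundarySimplex k).faces ↔ A.card ∈ Finset.Icc 1 (k - 1) := by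
  have h1 : A ∈ (boundarySimplex k).faces ↔ A.Nonempty ∧ A ≠ Finset.univ := Iff.rfl
  rw [h1, ne_univ_iff_card_mem_range, ← Finset.card_pos, Finset.mem_range, Finset.mem_Icc]
  omega

theorem mem_SdBoundary_iff {c : Finset (Finset (Fin k))} :
    c ∈ (SdBoundary k).faces ↔ c.Nonempty ∧
      (∀ A ∈ c, A.card ∈ Finset.Icc 1 (k - 1)) ∧ IsFlag c := by
  simp only [← mem_boundarySimplex_iff]
  exact Iff.rfl

theorem fNum_SdBoundary (hk : 1 ≤ k) {m : ℕ} (hm : m ≤ k - 1) :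
    fNum (SdBoundary k) m = ∑ π : Equiv.Perm (Fin k), (k - 1 - des π).choose (k - 1 - m) := by
  have h := ncard_flags (k := k) (S := Finset.Icc 1 (k - 1)) le_rfl (fun x => by
    simp only [Finset.mem_Icc, Finset.mem_range]; omega) (i := 0) (m := m) (by omega)
    (by simpa using hm)
  rw [Finset.filter_true_of_mem fun π _ => Nat.lt_of_succ_le (init_mem hk π).1] at h
  simp only [Nat.card_Icc, Nat.add_sub_cancel] at h
  rw [← h, fNum]
  split_ifs with h0
  · subst h0
    symm
    rw [Set.ncard_eq_one]
    refine ⟨∅, Set.eq_singleton_iff_unique_mem.mpr ⟨⟨?_, by simp, rfl, fun t _ _ => by omega⟩,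
      fun c hc => Finset.card_eq_zero.mp hc.2.2.1⟩⟩
    simp [IsFlag, IsChain]
  · congr 1
    ext c
    constructor
    · rintro ⟨h1, h2⟩
      have h3 := mem_SdBoundary_iff.1 h1
      exact ⟨h3.2.2, h3.2.1, h2, fun t _ _ => by omega⟩
    · rintro ⟨h1, h2, h3, -⟩
      refine ⟨mem_SdBoundary_iff.2 ⟨?_, h2, h1⟩, h3⟩
      rw [← Finset.card_pos]
      omega

theorem rank_SdBoundary (hk : 1 ≤ k) : rank (SdBoundary k) = k - 1 := by
  refine rank_eq_of_forall_card_le ?_ ?_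
  · intro c hc
    obtain ⟨-, h1, h2⟩ := mem_SdBoundary_iff.1 hc
    have hsub := Finset.image_subset_iff.mpr h1
    have hcard : (c.image Finset.card).card = c.card := by
      conv_rhs => rw [← flagOf_flagPerm h2]
      refine (card_flagOf _ fun d hd => ?_).symm
      have := Finset.mem_Icc.mp (hsub hd)
      omega
    simpa [hcard] using Finset.card_le_card hsub
  · rw [fNum_SdBoundary hk le_rfl]
    refine (Finset.sum_pos (fun π _ => ?_) ⟨1, Finset.mem_univ _⟩).ne'
    simp

theorem hNum_SdBoundary (hk : 1 ≤ k) {j : ℕ} (hj : j ≤ k - 1) :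
    hNum (SdBoundary k) j = ∑ π : Equiv.Perm (Fin k) with des π = j, (1 : ℤ) :=
  hNum_eq_sum_of_fNum_eq (SdBoundary k) (k - 1) (fun _ => 1) des (rank_SdBoundary hk) des_le
    (fun m hm => by rw [fNum_SdBoundary hk hm]; push_cast; simp) j hj

/-! ### Sums over the rows of `H k` -/

/-- The rows partition the permutations by `init`, so weights on rows become weights on
permutations. -/
theorem sum_mul_hRow (s : Finset ℕ) (g : ℕ → ℤ) (d : Fin k) :
    ∑ t ∈ s, g t * hRow k t d =
      ∑ π : Equiv.Perm (Fin k) with des π = d, if init π ∈ s then g (init π) else 0 := by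
  have h1 : ∀ t, hRow k t d =
      ∑ π : Equiv.Perm (Fin k) with des π = d, if init π = t then 1 else 0 := by
    intro t
    rw [hRow, Set.ncard_eq_toFinset_card', ← Finset.sum_filter, Finset.sum_const,
      Finset.filter_filter, nsmul_one]
    congr 2
    ext π
    simp [and_comm]
  simp only [h1, Finset.mul_sum]
  rw [Finset.sum_comm]
  refine Finset.sum_congr rfl fun π _ => ?_
  simp

end EdgewiseSubdivision

theorem mainTheorem9 (k q : ℕ) (hk : 1 ≤ k) (v : Fin (k - 1) → ℤ)
    (hF : EdgewiseSubdivision.IsFacet k q v 1)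
    (hint : ∀ w ∈ EdgewiseSubdivision.F k v 1,
      (fun i => (w i : ℝ)) ∈ interior (EdgewiseSubdivision.R k q)) :
    -- `dim SC = k - 1`, so the `h`-vector has the entries `h_0, …, h_k`, the last of which is `0`
    EdgewiseSubdivision.rank (EdgewiseSubdivision.SC k q v) = k ∧
    EdgewiseSubdivision.hNum (EdgewiseSubdivision.SC k q v) k = 0 ∧
    (fun j : Fin k => EdgewiseSubdivision.hNum (EdgewiseSubdivision.SC k q v) j) =
      (fun i : Fin k => ((i : ℕ) : ℤ) + 1) ᵥ* EdgewiseSubdivision.H k ∧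
    (fun j : Fin k => EdgewiseSubdivision.hNum (EdgewiseSubdivision.SC k q v) j) =
      ∑ t ∈ Finset.Icc 1 k, (t : ℤ) • EdgewiseSubdivision.hRow k t ∧
    -- `dim Sd = k - 2`, so the `h`-vector of `Sd` has the entries `h_0, …, h_{k-1}`
    EdgewiseSubdivision.rank (EdgewiseSubdivision.SdBoundary k) = k - 1 ∧
    (fun j : Fin k => EdgewiseSubdivision.hNum (EdgewiseSubdivision.SC k q v) j) =
      (k : ℤ) • (fun j : Fin k => EdgewiseSubdivision.hNum (EdgewiseSubdivision.SdBoundary k) j) -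
        ∑ t ∈ Finset.Icc 1 (k - 1), ((k : ℤ) - t) • EdgewiseSubdivision.hRow k t ∧
    ∀ j ≤ k, EdgewiseSubdivision.hNum (EdgewiseSubdivision.SC k q v) j =
      ∑ π : Equiv.Perm (Fin k) with EdgewiseSubdivision.des π = j,
        (EdgewiseSubdivision.init π : ℤ) := by
  open EdgewiseSubdivision in
  have hrow : (fun j : Fin k => hNum (SC k q v) j) =
      ∑ t ∈ Finset.Icc 1 k, (t : ℤ) • hRow k t := by
    ext d
    rw [hNum_SC hk hint d.2.le, Finset.sum_apply]
    simp only [Pi.smul_apply, smul_eq_mul]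
    rw [sum_mul_hRow (Finset.Icc 1 k) (fun t => (t : ℤ)) d]
    refine Finset.sum_congr rfl fun π _ => ?_
    rw [if_pos (Finset.mem_Icc.mpr ⟨(init_mem hk π).1, (init_mem hk π).2.1⟩)]
  refine ⟨rank_SC hk hint, ?_, ?_, hrow, rank_SdBoundary hk, ?_, fun j hj => hNum_SC hk hint hj⟩
  · rw [hNum_SC hk hint le_rfl, Finset.filter_false_of_mem, Finset.sum_empty]
    intro π _
    have := des_le π
    omega
  · rw [hrow]
    ext d
    rw [Finset.sum_apply, Matrix.vecMul, dotProduct]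
    simp only [Pi.smul_apply, smul_eq_mul, H, Matrix.of_apply]
    rw [Fin.sum_univ_eq_sum_range (fun i => ((i : ℤ) + 1) * hRow k (i + 1) d),
      show Finset.Icc 1 k = Finset.Ico 1 (k + 1) from rfl, Finset.sum_Ico_eq_sum_range,
      Nat.add_sub_cancel]
    refine Finset.sum_congr rfl fun t _ => ?_
    rw [add_comm 1 t]
    push_cast
    rfl
  · ext d
    rw [Pi.sub_apply, Pi.smul_apply, hNum_SC hk hint d.2.le,
      hNum_SdBoundary hk (Nat.le_sub_one_of_lt d.2), Finset.sum_apply]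
    simp only [Pi.smul_apply, smul_eq_mul]
    rw [sum_mul_hRow (Finset.Icc 1 (k - 1)) (fun t => (k : ℤ) - t) d, Finset.mul_sum,
      ← Finset.sum_sub_distrib]
    refine Finset.sum_congr rfl fun π _ => ?_
    have h1 := (init_mem hk π).1
    have h2 := (init_mem hk π).2.1
    split_ifs with h
    · ring
    -- Only `init π = k` escapes the range, and there the correction `k - init π` vanishes.
    · rw [Finset.mem_Icc] at h
      omega
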